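/- Let $X_1,X_2,\ldots$ be i.i.d. $\mathrm{Bern}(\theta)$ random variables, $\theta\in[0,1]$. For $S\ge 1$ let $[S]=\{1,\dots,S\}$. A deterministic (time-invariant) $S$-state estimation procedure consists of a transition function $f:[S]\times\{0,1\}\to[S]$, an estimate function $\hat\theta:[S]\to[0,1]$ and a fixed initial state $s_{\mathrm{init}}\in[S]$; its memory state evolves by $M_0=s_{\mathrm{init}}$, $M_n=f(M_{n-1},X_n)$. Its asymptotic quadratic risk at $\theta$ is $$R_\theta(f,\hat\theta)=\lim_{n\to\infty}\frac1n\sum_{i=1}^n\mathbb{E}\big(\hat\theta(M_i)-\theta\big)^2 .$$ This limit exists for every such procedure and every $\theta\in[0,1]$, and the minimax risk $$R(S)=\inf_{f,\hat\theta,s_{\mathrm{init}}}\ \sup_{\theta\in[0,1]}R_\theta(f,\hat\theta),$$ where the infimum is over all deterministic $S$-state estimation procedures, satisfies $$R(S)=O\!\left(\frac1S\right)\qquad(S\to\infty).$$ -/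

import Mathlib

open MeasureTheory Filter Topology
open scoped unitInterval

/-- A deterministic time-invariant `S`-state estimation procedure for a Bernoulli parameter:
a transition function, an estimate in `[0,1]` for every state, and a predetermined initial state.
The bit `true` stands for the sample value `1` and `false` for `0`. -/
structure EstimationProcedure (S : ℕ) where
  /-- the memory update function -/
  step : Fin S → Bool → Fin S
  /-- the estimate that is output in each state -/
  estimate : Fin S → I
  /-- the initial state -/
  init : Fin S

/-- The law of an i.i.d. sequence of `Bern(θ)` bits; the coordinate `x n` is the sample of
time `n + 1`. -/
noncomputable def iidBernoulli (θ : I) : Measure (ℕ → Bool) :=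
  Measure.infinitePi fun _ : ℕ => ProbabilityTheory.bernoulliMeasure true false θ

namespace EstimationProcedure

variable {S : ℕ}

/-- The memory state at time `n`, as a function of the input sequence. -/
def state (P : EstimationProcedure S) (x : ℕ → Bool) : ℕ → Fin S
  | 0 => P.init
  | n + 1 => P.step (P.state x n) (x n)

/-- The average over the times `1, …, n` of the expected squared error. -/
noncomputable def averageRisk (P : EstimationProcedure S) (θ : I) (n : ℕ) : ℝ :=
  (1 / (n : ℝ)) * ∑ i ∈ Finset.Icc 1 n,
    ∫ x, ((P.estimate (P.state x i) : ℝ) - (θ : ℝ)) ^ 2 ∂(iidBernoulli θ)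

/-- The asymptotic quadratic risk at the parameter `θ`: the limit of the averages. -/
noncomputable def risk (P : EstimationProcedure S) (θ : I) : ℝ :=
  limUnder atTop (P.averageRisk θ)

end EstimationProcedure

/-- The deterministic minimax risk: the infimum over all `S`-state procedures of the worst-case
asymptotic risk over `θ ∈ [0,1]`. -/
noncomputable def minimaxRisk (S : ℕ) : ℝ :=
  ⨅ P : EstimationProcedure S, ⨆ θ : I, P.risk θ

/-!
# The deterministic minimax risk of estimating a Bernoulli parameter is `O(1 / S)`

*Existence of the limit.* The memory is a finite Markov chain, so `𝔼 h(Mₙ) = (Tⁿ h)(s_init)` for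
its transition operator `T`. As `T` is a contraction of a finite-dimensional space, that space is
the direct sum of the fixed space of `T` and the range of `T - 1` (`isCompl_ker_range`), and the
Cesàro averages converge: they are constant on the first summand and telescope on the second. The
limit is the mean under a stationary distribution (`exists_stationary`).

*The machine.* With `K ≈ √S / 2`, put `K` cells in a row, with cell `i` estimating `i / K`. Inside
a cell the memory holds the current run of equal bits. A run of `k` ones moves the memory one cell
up, a run of `m` zeros one cell down, where `k` and `m` depend on the cell. Balancing the
stationary flux across suitable cuts gives the masses of neighbouring cells the exact ratio
`((1 - θ)⁻ᵐ - 1) / (θ⁻ᵏ - 1)`, where `k` and `m` are the run lengths that lead across their common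
boundary (`IsStationaryMean.cell_balance`). The long waiting times for runs need no separate
treatment, since this ratio concerns the occupation of whole cells.

*The run lengths.* Near `p = i / K ≤ 1 / 2` take `k = i` and the least `m` with `(1 - p)ᵐ ≤ pᵏ`,
and symmetrically for `p > 1 / 2`. By Bernoulli's inequality the ratio is then at most `1 / 2` for
`θ ≤ p - 16 / K` and at least `2` for `θ ≥ p + 16 / K` (`exists_run_lengths`). Hence the masses
decay geometrically away from `θ`, beyond a bounded number of cells, and the mean square error is
`O(1 / K²)` (`sum_mul_sq_le_of_decay`). The lengths are `m ≤ 1 + K log (K / i)`, and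
`∑ log (K / i) ≤ K` because `Kᴷ / K! ≤ eᴷ`, so the machine has `O(K²)` states (`exists_cells`).
-/

/-! ### Ergodic averages of a finite-state procedure -/

namespace EstimationProcedure

variable {S : ℕ}

lemma measurable_state (P : EstimationProcedure S) (n : ℕ) :
    Measurable fun x => P.state x n := by
  induction n with
  | zero => exact measurable_const
  | succ n ih =>
    exact (Measurable.of_discrete (f := fun q : Fin S × Bool => P.step q.1 q.2)).comp
      (ih.prodMk (measurable_pi_apply n))

lemma state_congr (P : EstimationProcedure S) {x y : ℕ → Bool} {n : ℕ}
    (h : ∀ i < n, x i = y i) : P.state x n = P.state y n := by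
  induction n with
  | zero => rfl
  | succ n ih => simp [state, ih fun i hi => h i (by omega), h n (by omega)]

instance (θ : I) : IsProbabilityMeasure (iidBernoulli θ) := by
  unfold iidBernoulli; infer_instance

/-- The memory at time `n` depends on the samples `x 0, …, x (n - 1)` only. -/
lemma indepFun_state (P : EstimationProcedure S) (θ : I) (n : ℕ) :
    ProbabilityTheory.IndepFun (fun x => P.state x n) (fun x => x n) (iidBernoulli θ) := by
  have h := ProbabilityTheory.iIndepFun_infinitePi
    (P := fun _ : ℕ => ProbabilityTheory.bernoulliMeasure true false θ)
    (X := fun _ (b : Bool) => b) (fun _ => measurable_id)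
  have h2 := h.indepFun_finset (Finset.range n) {n} (by simp) (fun i => measurable_pi_apply i)
  have h3 := h2.comp
    (φ := fun y => P.state (fun i => if hi : i ∈ Finset.range n then y ⟨i, hi⟩ else false) n)
    (ψ := fun y => y ⟨n, by simp⟩) .of_discrete .of_discrete
  convert! h3 using 1
  funext x
  exact P.state_congr fun i hi => by simp [hi]

/-- The Markov operator of the memory chain, acting on functions of the memory state:
`(P.transition θ h) s` is the expected value of `h` after one step from `s`. -/
noncomputable def transition (P : EstimationProcedure S) (θ : I) :
    (Fin S → ℝ) →ₗ[ℝ] (Fin S → ℝ) where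
  toFun h s := θ * h (P.step s true) + (1 - θ) * h (P.step s false)
  map_add' g h := by ext s; simp; ring
  map_smul' c h := by ext s; simp; ring

lemma transition_apply (P : EstimationProcedure S) (θ : I) (h : Fin S → ℝ) (s : Fin S) :
    P.transition θ h s = θ * h (P.step s true) + (1 - θ) * h (P.step s false) := rfl

lemma integral_bit (θ : I) (n : ℕ) (g : Bool → ℝ) :
    ∫ x, g (x n) ∂(iidBernoulli θ) = θ * g true + (1 - θ) * g false := by
  have h := measurePreserving_eval_infinitePi
    (fun _ : ℕ => ProbabilityTheory.bernoulliMeasure true false θ) n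
  have h2 : ∫ x, g (x n) ∂(iidBernoulli θ)
      = ∫ b, g b ∂(ProbabilityTheory.bernoulliMeasure true false θ) := by
    rw [← h.map_eq, integral_map (measurable_pi_apply n).aemeasurable]
    · rfl
    · exact AEStronglyMeasurable.of_discrete
  rw [h2, ProbabilityTheory.integral_bernoulliMeasure]
  simp

lemma integrable_of_state (P : EstimationProcedure S) (θ : I) (n : ℕ) (h : Fin S → Bool → ℝ) :
    Integrable (fun x => h (P.state x n) (x n)) (iidBernoulli θ) := by
  have hm : Measurable fun x : ℕ → Bool => h (P.state x n) (x n) :=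
    (Measurable.of_discrete (f := fun q : Fin S × Bool => h q.1 q.2)).comp
      ((P.measurable_state n).prodMk (measurable_pi_apply n))
  refine Integrable.of_bound hm.aestronglyMeasurable (∑ q : Fin S × Bool, |h q.1 q.2|) ?_
  refine ae_of_all _ fun x => ?_
  exact Finset.single_le_sum (f := fun q : Fin S × Bool => |h q.1 q.2|)
    (fun _ _ => abs_nonneg _) (Finset.mem_univ (P.state x n, x n))

lemma integral_state_succ (P : EstimationProcedure S) (θ : I) (n : ℕ) (h : Fin S → ℝ) :
    ∫ x, h (P.state x (n + 1)) ∂(iidBernoulli θ)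
      = ∫ x, P.transition θ h (P.state x n) ∂(iidBernoulli θ) := by
  have key : ∀ (g : Fin S → ℝ) (c : Bool → ℝ),
      ∫ x, g (P.state x n) * c (x n) ∂(iidBernoulli θ)
        = (∫ x, g (P.state x n) ∂(iidBernoulli θ)) * (θ * c true + (1 - θ) * c false) := by
    intro g c
    rw [(P.indepFun_state θ n).integral_fun_comp_mul_comp (P.measurable_state n).aemeasurable
      (measurable_pi_apply n).aemeasurable .of_discrete .of_discrete, integral_bit]
  have h1 : ∀ x : ℕ → Bool, h (P.state x (n + 1)) =
      h (P.step (P.state x n) true) * (if x n then 1 else 0)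
        + h (P.step (P.state x n) false) * (if x n then 0 else 1) := by
    intro x
    rw [state]
    cases x n <;> simp
  simp_rw [h1, transition_apply]
  rw [integral_add, integral_add, integral_const_mul, integral_const_mul,
    key (fun s => h (P.step s true)) (fun b => if b then 1 else 0),
    key (fun s => h (P.step s false)) (fun b => if b then 0 else 1)]
  · simp; ring
  · exact P.integrable_of_state θ n fun s _ => θ * h (P.step s true)
  · exact P.integrable_of_state θ n fun s _ => (1 - θ) * h (P.step s false)
  · exact P.integrable_of_state θ n fun s b => h (P.step s true) * (if b then 1 else 0)
  · exact P.integrable_of_state θ n fun s b => h (P.step s false) * (if b then 0 else 1)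

lemma integral_state (P : EstimationProcedure S) (θ : I) (n : ℕ) (h : Fin S → ℝ) :
    ∫ x, h (P.state x n) ∂(iidBernoulli θ) = (P.transition θ ^ n) h P.init := by
  induction n generalizing h with
  | zero => simp [state]
  | succ n ih => rw [integral_state_succ, ih, pow_succ, Module.End.mul_apply]

lemma norm_transition_le (P : EstimationProcedure S) (θ : I) (h : Fin S → ℝ) :
    ‖P.transition θ h‖ ≤ ‖h‖ := by
  rw [pi_norm_le_iff_of_nonneg (norm_nonneg _)]
  intro s
  have h0 := θ.2.1
  have h1 := θ.2.2
  have a := abs_le.1 (norm_le_pi_norm h (P.step s true))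
  have b := abs_le.1 (norm_le_pi_norm h (P.step s false))
  rw [transition_apply, Real.norm_eq_abs, abs_le]
  constructor <;> nlinarith

lemma norm_transition_pow_le (P : EstimationProcedure S) (θ : I) (n : ℕ) (h : Fin S → ℝ) :
    ‖(P.transition θ ^ n) h‖ ≤ ‖h‖ := by
  induction n with
  | zero => simp
  | succ n ih =>
    rw [pow_succ', Module.End.mul_apply]
    exact (P.norm_transition_le θ _).trans ih

/-- A function `T b - b` that `T` fixes is zero: otherwise `T ^ n b = b + n (T b - b)` would be
unbounded. In finite dimension the fixed space and the range of `T - 1` are then complementary. -/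
lemma isCompl_ker_range (P : EstimationProcedure S) (θ : I) :
    IsCompl (P.transition θ - 1).ker (P.transition θ - 1).range := by
  set T := P.transition θ with hT
  rw [Submodule.isCompl_iff_disjoint _ _
    (by rw [add_comm, LinearMap.finrank_range_add_finrank_ker]), Submodule.disjoint_def]
  rintro a ha ⟨b, rfl⟩
  rw [LinearMap.mem_ker] at ha
  set a := (T - 1) b with ha'
  have hTa : T a = a := by simpa [sub_eq_zero] using ha
  have hTb : T b = b + a := by simp [ha']
  have hpow : ∀ n : ℕ, (T ^ n) b = b + (n : ℝ) • a := by
    intro n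
    induction n with
    | zero => simp
    | succ n ih =>
      rw [pow_succ', Module.End.mul_apply, ih, map_add, map_smul, hTa, hTb]
      push_cast
      rw [add_smul, one_smul]; abel
  by_contra hne
  have hpos : 0 < ‖a‖ := norm_pos_iff.2 hne
  obtain ⟨n, hn⟩ := exists_nat_gt (2 * ‖b‖ / ‖a‖)
  rw [div_lt_iff₀ hpos] at hn
  have h1 : (n : ℝ) • a = (T ^ n) b - b := by rw [hpow]; abel
  have h2 : ‖(n : ℝ) • a‖ ≤ 2 * ‖b‖ := by
    rw [h1]
    refine (norm_sub_le _ _).trans ?_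
    linarith [P.norm_transition_pow_le θ n b]
  rw [norm_smul, Real.norm_natCast] at h2
  linarith

/-- The long-run distribution of the memory, as a positive functional: for every function `h` of
the memory state, the Cesàro averages of `𝔼 h(Mᵢ)` converge, and their limit is linear in `h`,
monotone, normalized and invariant under the transition operator. -/
lemma exists_stationary (P : EstimationProcedure S) (θ : I) :
    ∃ L : (Fin S → ℝ) →ₗ[ℝ] ℝ,
      (∀ h, Tendsto (fun n : ℕ => (1 / (n : ℝ)) * ∑ i ∈ Finset.Icc 1 n,
        ∫ x, h (P.state x i) ∂(iidBernoulli θ)) atTop (𝓝 (L h))) ∧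
      (∀ h, (∀ s, 0 ≤ h s) → 0 ≤ L h) ∧ L (fun _ => 1) = 1 ∧
      ∀ h, L (P.transition θ h) = L h := by
  set T := P.transition θ with hT
  have hc := P.isCompl_ker_range θ
  rw [← hT] at hc
  set Q := (T - 1).ker.projection (T - 1).range hc with hQ
  -- `Q` projects onto the fixed space along the range of `T - 1`.
  have hdec : ∀ h, ∃ b, h = Q h + (T b - b) ∧ T (Q h) = Q h := by
    intro h
    have hk : Q h ∈ (T - 1).ker := Submodule.projection_apply_mem _ _
    have hr : h - Q h ∈ (T - 1).range := by
      have := Submodule.sub_projection_mem hc h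
      exact this
    obtain ⟨b, hb⟩ := hr
    refine ⟨b, ?_, ?_⟩
    · have : T b - b = h - Q h := by simpa using hb
      rw [this]; abel
    · simpa [sub_eq_zero] using hk
  have hlim : ∀ h, Tendsto (fun n : ℕ => (1 / (n : ℝ)) * ∑ i ∈ Finset.Icc 1 n,
        ∫ x, h (P.state x i) ∂(iidBernoulli θ)) atTop (𝓝 (Q h P.init)) := by
    intro h
    obtain ⟨b, hb, hfix⟩ := hdec h
    have hsum : ∀ n : ℕ, ∑ i ∈ Finset.Icc 1 n, ∫ x, h (P.state x i) ∂(iidBernoulli θ)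
        = n * Q h P.init + ((T ^ (n + 1)) b P.init - T b P.init) := by
      intro n
      induction n with
      | zero => simp
      | succ n ih =>
        rw [Finset.sum_Icc_succ_top (by omega), ih, P.integral_state]
        have hf : ∀ m : ℕ, (T ^ m) (Q h) = Q h := by
          intro m
          induction m with
          | zero => simp
          | succ m ihm => rw [pow_succ, Module.End.mul_apply, hfix, ihm]
        have h2 : (T ^ (n + 1)) h
            = Q h + ((T ^ (n + 1 + 1)) b - (T ^ (n + 1)) b) := by
          conv_lhs => rw [hb]
          rw [map_add, map_sub, hf, pow_succ T (n + 1), Module.End.mul_apply]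
        rw [← hT, h2]
        simp only [Pi.add_apply, Pi.sub_apply]
        push_cast
        ring
    have herr : Tendsto (fun n : ℕ => (1 / (n : ℝ)) * ((T ^ (n + 1)) b P.init - T b P.init))
        atTop (𝓝 0) := by
      refine squeeze_zero_norm (a := fun n : ℕ => (2 * ‖b‖) * (1 / (n : ℝ))) (fun n => ?_) ?_
      · rw [norm_mul, Real.norm_of_nonneg (by positivity), mul_comm]
        refine mul_le_mul_of_nonneg_right ?_ (by positivity)
        have h1 := (norm_le_pi_norm ((T ^ (n + 1)) b) P.init).trans
          (P.norm_transition_pow_le θ (n + 1) b)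
        have h2 := (norm_le_pi_norm (T b) P.init).trans (P.norm_transition_le θ b)
        exact (norm_sub_le _ _).trans (by linarith)
      · simpa using (tendsto_one_div_atTop_nhds_zero_nat (𝕜 := ℝ)).const_mul (2 * ‖b‖)
    have h3 := herr.const_add (Q h P.init)
    rw [add_zero] at h3
    refine h3.congr' ?_
    filter_upwards [eventually_gt_atTop 0] with n hn
    have : (n : ℝ) ≠ 0 := by positivity
    rw [hsum]
    field_simp
  refine ⟨(LinearMap.proj P.init).comp Q, hlim, ?_, ?_, ?_⟩
  · intro h hh
    refine ge_of_tendsto' (hlim h) fun n => ?_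
    exact mul_nonneg (by positivity)
      (Finset.sum_nonneg fun i _ => integral_nonneg fun x => hh _)
  · refine tendsto_nhds_unique (hlim fun _ => 1) (tendsto_const_nhds.congr' ?_)
    filter_upwards [eventually_gt_atTop 0] with n hn
    have : (n : ℝ) ≠ 0 := by positivity
    simp [this]
  · intro h
    have h0 : T h - h ∈ (T - 1).range := ⟨h, by simp⟩
    have h1 : Q (T h - h) = 0 := by
      exact (Submodule.projection_apply_eq_zero_iff hc).2 h0
    have h2 : Q (T h) = Q h := by rwa [map_sub, sub_eq_zero] at h1
    simp [h2]

/-- The asymptotic risk is a genuine limit. -/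
lemma tendsto_averageRisk (P : EstimationProcedure S) (θ : I) :
    Tendsto (P.averageRisk θ) atTop (𝓝 (P.risk θ)) := by
  obtain ⟨L, hL, -⟩ := P.exists_stationary θ
  exact tendsto_nhds_limUnder ⟨_, hL fun s => ((P.estimate s : ℝ) - θ) ^ 2⟩

lemma risk_nonneg (P : EstimationProcedure S) (θ : I) : 0 ≤ P.risk θ :=
  ge_of_tendsto' (P.tendsto_averageRisk θ) fun n => mul_nonneg (by positivity)
    (Finset.sum_nonneg fun i _ => integral_nonneg fun x => sq_nonneg _)

end EstimationProcedure

lemma minimaxRisk_nonneg (S : ℕ) : 0 ≤ minimaxRisk S :=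
  Real.iInf_nonneg fun P => Real.iSup_nonneg fun θ => P.risk_nonneg θ

lemma minimaxRisk_le {S : ℕ} (P : EstimationProcedure S) {c : ℝ} (h : ∀ θ : I, P.risk θ ≤ c) :
    minimaxRisk S ≤ c :=
  (ciInf_le ⟨0, by rintro _ ⟨P, rfl⟩; exact Real.iSup_nonneg fun θ => P.risk_nonneg θ⟩ P).trans
    (ciSup_le h)

/-! ### Separating nearby parameters by runs -/

/-- The parameter `θ` favours `k` ones over `m` zeros by a factor two: in the odds form
`(1 - θ)⁻ᵐ - 1 ≥ 2 (θ⁻ᵏ - 1)`, cleared of denominators. Accordingly,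
`FavoursOnes m k (1 - θ)` says that `θ` favours `m` zeros over `k` ones. -/
def FavoursOnes (k m : ℕ) (θ : ℝ) : Prop :=
  2 * ((1 - θ) ^ m * (1 - θ ^ k)) ≤ θ ^ k * (1 - (1 - θ) ^ m)

/-- Bernoulli's inequality, in a form that needs no division by `x`. -/
lemma one_add_mul_pow_le {x y t : ℝ} (k : ℕ) (hx : 0 ≤ x) (ht : 0 ≤ t) (h : x * (1 + t) ≤ y) :
    (1 + k * t) * x ^ k ≤ y ^ k := by
  have h1 : 1 + k * t ≤ (1 + t) ^ k := one_add_mul_le_pow (by linarith) k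
  calc (1 + k * t) * x ^ k ≤ (1 + t) ^ k * x ^ k := by gcongr
    _ = (x * (1 + t)) ^ k := by rw [mul_pow, mul_comm]
    _ ≤ y ^ k := by gcongr

/-- Around `p = i / K ≤ 1 / 2`, a run of `i` ones is balanced against a run of `m` zeros, where
`m` is the least number with `(1 - p) ^ m ≤ p ^ i`. -/
lemma exists_run_lengths_of_le_half {K i : ℕ} (hi : 1 ≤ i) (hiK : 2 * i ≤ K) :
    ∃ m : ℕ, 1 ≤ m ∧ (m : ℝ) ≤ 1 + K * Real.log (K / i) ∧ ∀ θ : ℝ, 0 ≤ θ → θ ≤ 1 →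
      (K * θ ≤ i - 16 → FavoursOnes m i (1 - θ)) ∧ (i + 16 ≤ K * θ → FavoursOnes i m θ) := by
  have hi0 : (1 : ℝ) ≤ i := by exact_mod_cast hi
  have hiKr : 2 * (i : ℝ) ≤ K := by exact_mod_cast hiK
  have hK0 : (0 : ℝ) < K := by linarith
  obtain ⟨p, hp⟩ : ∃ p : ℝ, p = i / K := ⟨_, rfl⟩
  have hKp : K * p = i := by rw [hp]; field_simp
  have hp0 : 0 < p := by rw [hp]; positivity
  have hp2 : p ≤ 1 / 2 := by nlinarith
  have hex : ∃ m : ℕ, (1 - p) ^ m ≤ p ^ i := by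
    obtain ⟨m, hm⟩ := exists_pow_lt_of_lt_one (pow_pos hp0 i) (by linarith : 1 - p < 1)
    exact ⟨m, hm.le⟩
  classical
  obtain ⟨m, hm⟩ : ∃ m, m = Nat.find hex := ⟨_, rfl⟩
  have hmle : (1 - p) ^ m ≤ p ^ i := hm ▸ Nat.find_spec hex
  have hPhalf : p ^ i ≤ 1 / 2 := by
    calc p ^ i ≤ p ^ 1 := pow_le_pow_of_le_one hp0.le (by linarith) hi
      _ ≤ 1 / 2 := by simpa using hp2
  have hm1 : 1 ≤ m := by
    by_contra h
    have : m = 0 := by omega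
    rw [this] at hmle
    norm_num at hmle
    linarith
  have hmgt : p ^ i < (1 - p) ^ (m - 1) := by
    have := Nat.find_min hex (m := m - 1) (by omega)
    exact not_le.1 this
  have hP0 : 0 < p ^ i := pow_pos hp0 i
  have hmge : p ^ i / 2 ≤ (1 - p) ^ m := by
    obtain ⟨l, rfl⟩ : ∃ l, m = l + 1 := ⟨m - 1, by omega⟩
    simp only [Nat.add_sub_cancel] at hmgt
    rw [pow_succ]
    nlinarith
  have hlogp : Real.log (K / i) = - Real.log p := by
    rw [hp, ← Real.log_inv, inv_div]
  -- Both bounds on `m` come from taking logarithms in its defining inequalities.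
  have hlog1 : Real.log (1 - p) ≤ -p := by
    have := Real.log_le_sub_one_of_pos (by linarith : 0 < 1 - p)
    linarith
  have hlog2 : -(2 * p) ≤ Real.log (1 - p) := by
    have h := Real.one_sub_inv_le_log_of_pos (by linarith : 0 < 1 - p)
    have : 1 - (1 - p)⁻¹ ≥ -(2 * p) := by
      have h3 : (1 - p)⁻¹ ≤ 1 + 2 * p := by
        rw [inv_le_iff_one_le_mul₀ (by linarith)]
        nlinarith
      linarith
    linarith
  have hmub : (m : ℝ) ≤ 1 + K * Real.log (K / i) := by
    have h := Real.log_lt_log hP0 hmgt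
    rw [Real.log_pow, Real.log_pow, Nat.cast_sub hm1] at h
    rw [hlogp]
    push_cast at h
    have hm1' : (0 : ℝ) ≤ m - 1 := by
      have : (1 : ℝ) ≤ m := by exact_mod_cast hm1
      linarith
    have h2 : (m - 1) * p ≤ -(i * Real.log p) := by nlinarith
    rw [← hKp] at h2
    have h3 : (m - 1) ≤ -(K * Real.log p) := by
      refine le_of_mul_le_mul_right ?_ hp0
      linarith
    linarith
  have hmlb : (K : ℝ) ≤ 4 * m := by
    have h := Real.log_le_log (pow_pos (by linarith : 0 < 1 - p) m) hmle
    rw [Real.log_pow, Real.log_pow] at h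
    have hlp : Real.log p ≤ -(1 / 2) := by
      have := Real.log_le_sub_one_of_pos hp0
      linarith
    have h2 : (m : ℝ) * -(2 * p) ≤ m * Real.log (1 - p) := by gcongr
    have h3 : (i : ℝ) * Real.log p ≤ i * -(1 / 2) := by gcongr
    have h4 : (K * p) * (1 / 2) ≤ m * (2 * p) := by rw [hKp]; linarith
    have h5 : p * K ≤ p * (4 * m) := by linarith
    exact le_of_mul_le_mul_left h5 hp0
  refine ⟨m, hm1, hmub, fun θ h0 h1 => ⟨fun hθ => ?_, fun hθ => ?_⟩⟩
  · have hθp : θ ≤ p := by nlinarith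
    have hy : p ^ i / 2 ≤ (1 - θ) ^ m := by
      refine hmge.trans ?_
      gcongr
      linarith
    have hx : 17 * θ ^ i ≤ p ^ i := by
      have h := one_add_mul_pow_le (x := θ) (y := p) (t := 16 / i) i h0 (by positivity) (by
        have : θ * (16 / i) ≤ 16 / K := by
          rw [mul_div_assoc', div_le_div_iff₀ (by linarith) hK0]
          nlinarith
        have h6 : θ ≤ p - 16 / K := by
          rw [hp, ← sub_div, le_div_iff₀ hK0]; linarith
        linarith)
      have e : (1 : ℝ) + i * (16 / i) = 17 := by field_simp; norm_num
      rwa [e] at h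
    have hx0 : 0 ≤ θ ^ i := by positivity
    have hy1 : 0 ≤ (1 - θ) ^ m := pow_nonneg (by linarith) m
    unfold FavoursOnes
    rw [sub_sub_cancel]
    generalize θ ^ i = x at *
    generalize (1 - θ) ^ m = y at *
    nlinarith
  · have hpθ : p ≤ θ := by nlinarith
    have hx : p ^ i ≤ θ ^ i := by gcongr
    have hy : 5 * (1 - θ) ^ m ≤ p ^ i := by
      have h := one_add_mul_pow_le (x := 1 - θ) (y := 1 - p) (t := 16 / K) m (by linarith)
        (by positivity) (by
        have : (1 - θ) * (16 / K) ≤ 16 / K := mul_le_of_le_one_left (by positivity) (by linarith)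
        have h6 : p + 16 / K ≤ θ := by
          rw [hp, ← add_div, div_le_iff₀ hK0]; linarith
        linarith)
      have e : (5 : ℝ) ≤ 1 + m * (16 / K) := by
        have : 4 ≤ m * (16 / K : ℝ) := by
          rw [mul_div_assoc', le_div_iff₀ hK0]; linarith
        linarith
      have hy1 : 0 ≤ (1 - θ) ^ m := pow_nonneg (by linarith) m
      calc 5 * (1 - θ) ^ m ≤ (1 + m * (16 / K)) * (1 - θ) ^ m := by gcongr
        _ ≤ (1 - p) ^ m := h
        _ ≤ p ^ i := hmle
    have hx1 : θ ^ i ≤ 1 := pow_le_one₀ h0 h1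
    have hy1 : 0 ≤ (1 - θ) ^ m := pow_nonneg (by linarith) m
    unfold FavoursOnes
    generalize θ ^ i = x at *
    generalize (1 - θ) ^ m = y at *
    nlinarith

/-- Run lengths whose competition separates `θ ≤ (i - 16) / K` from `θ ≥ (i + 16) / K`. For
`i > K / 2` exchange the roles of ones and zeros. -/
lemma exists_run_lengths {K i : ℕ} (hi : 1 ≤ i) (hiK : i < K) :
    ∃ k m : ℕ, 1 ≤ k ∧ 1 ≤ m ∧
      (k + m : ℝ) ≤ K + 1 + K * Real.log (K / i) + K * Real.log (K / (K - i : ℕ)) ∧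
      ∀ θ : ℝ, 0 ≤ θ → θ ≤ 1 →
        (K * θ ≤ i - 16 → FavoursOnes m k (1 - θ)) ∧ (i + 16 ≤ K * θ → FavoursOnes k m θ) := by
  have hlog : ∀ j : ℕ, 1 ≤ j → j ≤ K → 0 ≤ K * Real.log (K / j) := by
    intro j hj hjK
    have h1 : (1 : ℝ) ≤ j := by exact_mod_cast hj
    refine mul_nonneg (by positivity) (Real.log_nonneg ?_)
    rw [le_div_iff₀ (by linarith), one_mul]
    exact_mod_cast hjK
  have hl1 := hlog i hi hiK.le
  have hl2 := hlog (K - i) (by omega) (by omega)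
  have hiK' : (i : ℝ) ≤ K := by exact_mod_cast hiK.le
  rcases le_or_gt (2 * i) K with h | h
  · obtain ⟨m, hm1, hm2, hm⟩ := exists_run_lengths_of_le_half hi h
    exact ⟨i, m, hi, hm1, by linarith, hm⟩
  · obtain ⟨k, hk1, hk2, hk⟩ :=
      exists_run_lengths_of_le_half (K := K) (i := K - i) (by omega) (by omega)
    have hcast : ((K - i : ℕ) : ℝ) = K - i := by rw [Nat.cast_sub hiK.le]
    refine ⟨k, K - i, hk1, by omega, by linarith, fun θ h0 h1 => ?_⟩
    obtain ⟨h2, h3⟩ := hk (1 - θ) (by linarith) (by linarith)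
    rw [sub_sub_cancel] at h2
    refine ⟨fun hθ => h3 ?_, fun hθ => h2 ?_⟩ <;> rw [hcast] <;> linarith

/-- The logarithms in the run lengths are summable, as `K ^ K / K! ≤ exp K`. -/
lemma sum_log_div_le (K : ℕ) :
    ∑ i ∈ Finset.range (K - 1), Real.log (K / (i + 1 : ℕ)) ≤ K := by
  rcases Nat.eq_zero_or_pos K with rfl | hK
  · simp
  have hK0 : (0 : ℝ) < K := by exact_mod_cast hK
  have hprod : ∀ n : ℕ, ∑ i ∈ Finset.range n, Real.log (K / (i + 1 : ℕ))
      = Real.log (K ^ n / n.factorial) := by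
    intro n
    induction n with
    | zero => simp
    | succ n ih =>
      have hf : (0 : ℝ) < n.factorial := by exact_mod_cast n.factorial_pos
      rw [Finset.sum_range_succ, ih, ← Real.log_mul (by positivity) (by positivity),
        Nat.factorial_succ]
      congr 1
      push_cast
      field_simp
      ring
  rw [hprod]
  have hf : (0 : ℝ) < (K - 1).factorial := by exact_mod_cast (K - 1).factorial_pos
  rw [Real.log_le_iff_le_exp (by positivity)]
  exact Real.pow_div_factorial_le_exp _ hK0.le _

/-! ### Second moments of geometrically decaying weights -/

lemma sum_mul_sq_le_of_decay_right {N : ℕ} {W : ℕ → ℝ} {t c : ℝ} (hc : 1 ≤ c) (ht : -c < t)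
    (hW : ∀ i, 0 ≤ W i) (hsum : ∑ i ∈ Finset.range (N + 1), W i = 1)
    (hdec : ∀ i < N, t + c ≤ i + 1 → 2 * W (i + 1) ≤ W i) :
    ∑ i ∈ Finset.range (N + 1), W i * (if c ≤ i - t then ((i : ℝ) - t) ^ 2 else 0)
      ≤ 3 * c ^ 2 + 6 := by
  set f : ℕ → ℝ := fun i => if c ≤ i - t then ((i : ℝ) - t) ^ 2 else 0 with hf
  have hf0 : ∀ i, 0 ≤ f i := fun i => by simp only [hf]; split_ifs <;> positivity
  -- Shifting the index costs a factor `3 / 2` in `f`, which the decay by `1 / 2` compensates.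
  have hstep : ∀ i < N, W (i + 1) * f (i + 1)
      ≤ 3 / 4 * (W i * f i) + (3 / 4 * c ^ 2 + 3 / 2) * W i := by
    intro i hi
    by_cases h : c ≤ (i + 1 : ℕ) - t
    · have hd := hdec i hi (by push_cast at h; linarith)
      have hle : f (i + 1) ≤ 3 / 2 * f i + (3 / 2 * c ^ 2 + 3) := by
        simp only [hf, if_pos h]
        push_cast at h ⊢
        split_ifs with h2 <;> nlinarith [sq_nonneg ((i : ℝ) - t - 2), sq_nonneg (c - 2)]
      have h1 : W (i + 1) * f (i + 1) ≤ W i / 2 * f (i + 1) :=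
        mul_le_mul_of_nonneg_right (by linarith) (hf0 _)
      have h2 : W i / 2 * f (i + 1) ≤ W i / 2 * (3 / 2 * f i + (3 / 2 * c ^ 2 + 3)) :=
        mul_le_mul_of_nonneg_left hle (by linarith [hW i])
      linarith
    · have : f (i + 1) = 0 := by simp only [hf, if_neg h]
      rw [this, mul_zero]
      have := mul_nonneg (hW i) (hf0 i)
      have := mul_nonneg (by positivity : 0 ≤ 3 / 4 * c ^ 2 + 3 / 2) (hW i)
      linarith
  have hzero : f 0 = 0 := by
    simp only [hf]
    rw [if_neg]
    push_cast
    linarith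
  have hsub : ∀ g : ℕ → ℝ, (∀ i, 0 ≤ g i) →
      ∑ i ∈ Finset.range N, g i ≤ ∑ i ∈ Finset.range (N + 1), g i := fun g hg => by
    rw [Finset.sum_range_succ]; linarith [hg N]
  have h1 : ∑ i ∈ Finset.range (N + 1), W i * f i
      = ∑ i ∈ Finset.range N, W (i + 1) * f (i + 1) := by
    rw [Finset.sum_range_succ', hzero]; simp
  have h2 := Finset.sum_le_sum fun i hi => hstep i (Finset.mem_range.1 hi)
  rw [Finset.sum_add_distrib, ← Finset.mul_sum, ← Finset.mul_sum, ← h1] at h2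
  have h3 := hsub (fun i => W i * f i) fun i => mul_nonneg (hW i) (hf0 i)
  have h4 := hsub W hW
  rw [hsum] at h4
  have h5 : (3 / 4 * c ^ 2 + 3 / 2) * ∑ i ∈ Finset.range N, W i ≤ (3 / 4 * c ^ 2 + 3 / 2) * 1 :=
    mul_le_mul_of_nonneg_left h4 (by positivity)
  linarith

/-- Weights that halve at each step away from `t`, outside a window of bounded width, have a
bounded second moment about `t`. -/
lemma sum_mul_sq_le_of_decay {N : ℕ} {W : ℕ → ℝ} {t : ℝ} (ht0 : 0 ≤ t) (ht1 : t ≤ N + 1)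
    (hW : ∀ i, 0 ≤ W i) (hsum : ∑ i ∈ Finset.range (N + 1), W i = 1)
    (hright : ∀ i < N, t ≤ (i + 1 : ℕ) - 16 → 2 * W (i + 1) ≤ W i)
    (hleft : ∀ i < N, (i + 1 : ℕ) + 16 ≤ t → 2 * W i ≤ W (i + 1)) :
    ∑ i ∈ Finset.range (N + 1), W i * ((i : ℝ) - t) ^ 2 ≤ 2035 := by
  have h1 := sum_mul_sq_le_of_decay_right (c := 17) (t := t) (by norm_num) (by linarith) hW hsum
    fun i hi h => hright i hi (by push_cast; linarith)
  have h2 := sum_mul_sq_le_of_decay_right (c := 17) (t := N - t) (N := N)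
    (W := fun i => W (N - i)) (by norm_num)
    (by linarith) (fun i => hW _)
    (by rw [← hsum, ← Finset.sum_range_reflect W]; simp)
    (by
      intro i hi h
      have e : N - i = N - (i + 1) + 1 := by omega
      rw [e]
      refine hleft (N - (i + 1)) (by omega) ?_
      rw [← e, Nat.cast_sub hi.le]
      linarith)
  have h3 : ∑ i ∈ Finset.range (N + 1), W i * (if 17 ≤ t - i then ((i : ℝ) - t) ^ 2 else 0)
      ≤ 3 * 17 ^ 2 + 6 := by
    refine le_of_eq_of_le ?_ h2
    rw [← Finset.sum_range_reflect]
    refine Finset.sum_congr rfl fun i hi => ?_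
    have hi' : i ≤ N := by simpa [Nat.lt_succ_iff] using hi
    simp only [Nat.add_sub_cancel]
    rw [Nat.cast_sub hi']
    have e1 : t - ((N : ℝ) - i) = i - (N - t) := by ring
    have e2 : ((N : ℝ) - i - t) ^ 2 = (i - (N - t)) ^ 2 := by ring
    rw [e1, e2]
  have h4 : ∀ i ∈ Finset.range (N + 1), W i * ((i : ℝ) - t) ^ 2 ≤
      W i * (if 17 ≤ i - t then ((i : ℝ) - t) ^ 2 else 0)
      + W i * (if 17 ≤ t - i then ((i : ℝ) - t) ^ 2 else 0) + 289 * W i := by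
    intro i _
    have : ((i : ℝ) - t) ^ 2 ≤ (if 17 ≤ i - t then ((i : ℝ) - t) ^ 2 else 0)
      + (if 17 ≤ t - i then ((i : ℝ) - t) ^ 2 else 0) + 289 := by
      split_ifs with a b b
      · nlinarith
      · nlinarith
      · nlinarith
      · push Not at a b
        nlinarith
    nlinarith [mul_le_mul_of_nonneg_left this (hW i)]
  refine (Finset.sum_le_sum h4).trans ?_
  rw [Finset.sum_add_distrib, Finset.sum_add_distrib, ← Finset.mul_sum, hsum]
  linarith

/-! ### The chain of run-length cells -/

/-- A memory state of the chain: `(i, b, j)` means that cell `i` is occupied and the current run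
consists of `j + 1` bits equal to `b`. -/
abbrev RunState : Type := ℕ × Bool × ℕ

/-- The chain on the cells `0, …, N`. In cell `i`, a run of `ℓ true i` ones leads to cell `i + 1`,
entered as after one zero, and a run of `ℓ false i` zeros leads to cell `i - 1`, entered as after
one one. At the two ends a completed run that cannot leave stays at its full length. -/
def runStep (N : ℕ) (ℓ : Bool → ℕ → ℕ) : RunState → Bool → RunState
  | (i, true, j), true =>
    if j + 1 < ℓ true i then (i, true, j + 1) else if i < N then (i + 1, false, 0) else (i, true, j)
  | (i, true, _), false => (i, false, 0)
  | (i, false, j), false =>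
    if j + 1 < ℓ false i then (i, false, j + 1)
    else if 0 < i then (i - 1, true, 0) else (i, false, j)
  | (i, false, _), true => (i, true, 0)

/-- The states that the chain uses. -/
def runStates (N : ℕ) (ℓ : Bool → ℕ → ℕ) : Finset RunState :=
  (Finset.range (N + 1)).biUnion fun i => Finset.univ.biUnion fun b =>
    (Finset.range (ℓ b i)).image fun j => (i, b, j)

lemma mem_runStates {N : ℕ} {ℓ : Bool → ℕ → ℕ} {i : ℕ} {b : Bool} {j : ℕ} :
    (i, b, j) ∈ runStates N ℓ ↔ i ≤ N ∧ j < ℓ b i := by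
  simp only [runStates, Finset.mem_biUnion, Finset.mem_range, Finset.mem_image, Finset.mem_univ,
    Prod.mk.injEq, Nat.lt_succ_iff, true_and]
  constructor
  · rintro ⟨i, hi, b, j, hj, rfl, rfl, rfl⟩
    exact ⟨hi, hj⟩
  · rintro ⟨hi, hj⟩
    exact ⟨i, hi, b, j, hj, rfl, rfl, rfl⟩

lemma card_runStates_le (N : ℕ) (ℓ : Bool → ℕ → ℕ) :
    (runStates N ℓ).card ≤ ∑ i ∈ Finset.range (N + 1), (ℓ true i + ℓ false i) := by
  refine Finset.card_biUnion_le.trans (Finset.sum_le_sum fun i _ => ?_)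
  refine Finset.card_biUnion_le.trans ?_
  rw [Fintype.sum_bool]
  refine add_le_add ?_ ?_ <;> exact Finset.card_image_le.trans (by simp)

lemma runStep_mem {N : ℕ} {ℓ : Bool → ℕ → ℕ} (hℓ : ∀ b i, 1 ≤ ℓ b i) {q : RunState}
    (hq : q ∈ runStates N ℓ) (b : Bool) : runStep N ℓ q b ∈ runStates N ℓ := by
  obtain ⟨i, c, j⟩ := q
  rw [mem_runStates] at hq
  have h := fun b i => Nat.pos_of_ne_zero (Nat.one_le_iff_ne_zero.1 (hℓ b i))
  cases b <;> cases c <;> simp only [runStep] <;> (try split_ifs) <;>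
    simp only [mem_runStates, h, and_true] <;> omega

/-- A stationary distribution of the chain at the parameter `θ`, as a functional: linear, positive,
normalized, and invariant under one step of the chain. -/
structure IsStationaryMean {Q : Type*} (V : Finset Q) (step : Q → Bool → Q) (θ : ℝ)
    (E : (Q → ℝ) →ₗ[ℝ] ℝ) : Prop where
  nonneg : ∀ h : Q → ℝ, (∀ q ∈ V, 0 ≤ h q) → 0 ≤ E h
  one : E (fun _ => 1) = 1
  step_eq : ∀ h : Q → ℝ, E (fun q => θ * h (step q true) + (1 - θ) * h (step q false)) = E h

namespace IsStationaryMean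

lemma congr {Q : Type*} {V : Finset Q} {step : Q → Bool → Q} {θ : ℝ} {E : (Q → ℝ) →ₗ[ℝ] ℝ}
    (hE : IsStationaryMean V step θ E) {g h : Q → ℝ} (hgh : ∀ q ∈ V, g q = h q) : E g = E h := by
  have h1 := hE.nonneg (g - h) fun q hq => by simp [hgh q hq]
  have h2 := hE.nonneg (h - g) fun q hq => by simp [hgh q hq]
  rw [map_sub] at h1 h2
  linarith

/-- Under a stationary distribution, what one step adds to `h` on average (`a * f`) equals what it
removes (`b * g`). For the indicator `h` of a set of states these are the fluxes into and out of
the set. -/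
lemma flux_balance {Q : Type*} {V : Finset Q} {step : Q → Bool → Q} {θ : ℝ}
    {E : (Q → ℝ) →ₗ[ℝ] ℝ} (hE : IsStationaryMean V step θ E) (h : Q → ℝ) (a b : ℝ) (f g : Q → ℝ)
    (hfg : ∀ q ∈ V, θ * h (step q true) + (1 - θ) * h (step q false)
      = h q + (a * f q - b * g q)) :
    a * E f = b * E g := by
  have h1 := hE.congr (h := h + (a • f - b • g)) hfg
  rw [hE.step_eq, map_add, map_sub, map_smul, map_smul, smul_eq_mul, smul_eq_mul] at h1
  linarith

variable {N : ℕ} {ℓ : Bool → ℕ → ℕ} {θ : ℝ} {E : (RunState → ℝ) →ₗ[ℝ] ℝ}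

lemma run_ones (hE : IsStationaryMean (runStates N ℓ) (runStep N ℓ) θ E) {i : ℕ} (hi : i < N)
    {j : ℕ} (hj : j < ℓ true i) :
    E (fun q => if q = (i, true, j) then 1 else 0)
      = θ ^ j * E (fun q => if q = (i, true, 0) then 1 else 0) := by
  induction j with
  | zero => simp
  | succ j ih =>
    rw [pow_succ', mul_assoc, ← ih (by omega), ← one_mul (E _)]
    symm
    refine hE.flux_balance (fun q => if q = (i, true, j + 1) then 1 else 0) _ _ _ _ ?_
    rintro ⟨i', b, j'⟩ hq
    rw [mem_runStates] at hq
    cases b <;> simp only [runStep, Prod.mk.injEq] <;> grind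

lemma run_zeros (hE : IsStationaryMean (runStates N ℓ) (runStep N ℓ) θ E) {i : ℕ} (hi : 0 < i)
    {j : ℕ} (hj : j < ℓ false i) :
    E (fun q => if q = (i, false, j) then 1 else 0)
      = (1 - θ) ^ j * E (fun q => if q = (i, false, 0) then 1 else 0) := by
  induction j with
  | zero => simp
  | succ j ih =>
    rw [pow_succ', mul_assoc, ← ih (by omega), ← one_mul (E _)]
    symm
    refine hE.flux_balance (fun q => if q = (i, false, j + 1) then 1 else 0) _ _ _ _ ?_
    rintro ⟨i', b, j'⟩ hq
    rw [mem_runStates] at hq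
    cases b <;> simp only [runStep, Prod.mk.injEq] <;> grind

/-- The flux balance between the cells `0, …, i` and the cells `i + 1, …, N`. -/
lemma cut_cells (hE : IsStationaryMean (runStates N ℓ) (runStep N ℓ) θ E) (hℓ : ∀ b i, 1 ≤ ℓ b i)
    {i : ℕ} (hi : i < N) :
    (1 - θ) * E (fun q => if q = (i + 1, false, ℓ false (i + 1) - 1) then 1 else 0)
      = θ * E (fun q => if q = (i, true, ℓ true i - 1) then 1 else 0) := by
  have h1 := hℓ true i
  have h2 := hℓ false (i + 1)
  refine hE.flux_balance (fun q => if q.1 ≤ i then 1 else 0) _ _ _ _ ?_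
  rintro ⟨i', b, j'⟩ hq
  rw [mem_runStates] at hq
  cases b <;> simp only [runStep, Prod.mk.injEq] <;> grind

/-- The flux balance inside cell `i`, between the runs of zeros (together with all earlier cells)
and the runs of ones. -/
lemma cut_side (hE : IsStationaryMean (runStates N ℓ) (runStep N ℓ) θ E) (i : ℕ) :
    (1 - θ) * E (fun q => if q.1 = i ∧ q.2.1 = true then 1 else 0)
      = θ * E (fun q => if q.1 = i ∧ q.2.1 = false then 1 else 0) := by
  refine hE.flux_balance
    (fun q => if q.1 < i ∨ q.1 = i ∧ q.2.1 = false then 1 else 0) _ _ _ _ ?_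
  rintro ⟨i', b, j'⟩ hq
  rw [mem_runStates] at hq
  cases b <;> simp only [runStep] <;> grind

lemma side_eq_sum (hE : IsStationaryMean (runStates N ℓ) (runStep N ℓ) θ E) (i : ℕ) (b : Bool) :
    E (fun q => if q.1 = i ∧ q.2.1 = b then 1 else 0)
      = ∑ j ∈ Finset.range (ℓ b i), E (fun q => if q = (i, b, j) then 1 else 0) := by
  rw [← map_sum]
  refine hE.congr ?_
  rintro ⟨i', c, j'⟩ hq
  rw [mem_runStates] at hq
  rw [Finset.sum_apply]
  by_cases h : i' = i ∧ c = b
  · obtain ⟨rfl, rfl⟩ := h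
    simp [hq.2]
  · rw [if_neg h]
    refine (Finset.sum_eq_zero fun j _ => if_neg ?_).symm
    simp only [Prod.mk.injEq]
    tauto

lemma cell_eq_add (hE : IsStationaryMean (runStates N ℓ) (runStep N ℓ) θ E) (i : ℕ) :
    E (fun q => if q.1 = i then 1 else 0)
      = E (fun q => if q.1 = i ∧ q.2.1 = true then 1 else 0)
        + E (fun q => if q.1 = i ∧ q.2.1 = false then 1 else 0) := by
  rw [← map_add]
  refine hE.congr ?_
  rintro ⟨i', c, j'⟩ -
  cases c <;> simp

/-- The masses of neighbouring cells have the ratio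
`((1 - θ)⁻ᵐ - 1) / (θ⁻ᵏ - 1)`, where `k` and `m` are the lengths of the runs that lead across
their common boundary. -/
lemma cell_balance (hE : IsStationaryMean (runStates N ℓ) (runStep N ℓ) θ E)
    (hℓ : ∀ b i, 1 ≤ ℓ b i) {i : ℕ} (hi : i < N) :
    (1 - θ) ^ ℓ false (i + 1) * (1 - θ ^ ℓ true i) * E (fun q => if q.1 = i + 1 then 1 else 0)
      = θ ^ ℓ true i * (1 - (1 - θ) ^ ℓ false (i + 1)) *
        E (fun q => if q.1 = i then 1 else 0) := by
  have hcut := hE.cut_cells hℓ hi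
  have h1 := hℓ true i
  have h2 := hℓ false (i + 1)
  rw [hE.run_ones hi (by omega), hE.run_zeros (i := i + 1) i.succ_pos (by omega), ← mul_assoc,
    ← mul_assoc, ← pow_succ', ← pow_succ', Nat.sub_add_cancel h1, Nat.sub_add_cancel h2] at hcut
  have hA := hE.side_eq_sum i true
  rw [Finset.sum_congr rfl fun j hj => hE.run_ones hi (Finset.mem_range.1 hj),
    ← Finset.sum_mul] at hA
  have hB := hE.side_eq_sum (i + 1) false
  rw [Finset.sum_congr rfl fun j hj => hE.run_zeros (i := i + 1) i.succ_pos (Finset.mem_range.1 hj),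
    ← Finset.sum_mul] at hB
  have hc1 := hE.cut_side i
  have hc2 := hE.cut_side (i + 1)
  have hw1 := hE.cell_eq_add i
  have hw2 := hE.cell_eq_add (i + 1)
  have g1 := mul_neg_geom_sum θ (ℓ true i)
  have g2 := mul_neg_geom_sum (1 - θ) (ℓ false (i + 1))
  rw [sub_sub_cancel] at g2
  -- The runs of ones in a cell have the share `θ` of its mass, the runs of zeros `1 - θ`.
  have hA' : E (fun q => if q.1 = i ∧ q.2.1 = true then 1 else 0)
      = θ * E (fun q => if q.1 = i then 1 else 0) := by rw [hw1]; linarith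
  have hB' : E (fun q => if q.1 = i + 1 ∧ q.2.1 = false then 1 else 0)
      = (1 - θ) * E (fun q => if q.1 = i + 1 then 1 else 0) := by rw [hw2]; linarith
  rw [hA'] at hA
  rw [hB'] at hB
  rw [← g1, ← g2]
  generalize E (fun q => if q.1 = i then 1 else 0) = w at *
  generalize E (fun q => if q.1 = i + 1 then 1 else 0) = w' at *
  generalize E (fun q => if q = (i, true, 0) then 1 else 0) = x at *
  generalize E (fun q => if q = (i + 1, false, 0) then 1 else 0) = y at *
  generalize ∑ j ∈ Finset.range (ℓ true i), θ ^ j = G at *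
  generalize ∑ j ∈ Finset.range (ℓ false (i + 1)), (1 - θ) ^ j = H at *
  linear_combination (1 - θ) ^ ℓ false (i + 1) * G * hB - θ ^ ℓ true i * H * hA + G * H * hcut

lemma apply_comp_fst (hE : IsStationaryMean (runStates N ℓ) (runStep N ℓ) θ E) (f : ℕ → ℝ) :
    E (fun q => f q.1)
      = ∑ i ∈ Finset.range (N + 1), E (fun q => if q.1 = i then 1 else 0) * f i := by
  have h : ∀ i, E (fun q => if q.1 = i then 1 else 0) * f i
      = E (f i • fun q => if q.1 = i then 1 else 0) := fun i => by
    rw [map_smul, smul_eq_mul, mul_comm]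
  simp_rw [h]
  rw [← map_sum]
  refine hE.congr ?_
  rintro ⟨i, b, j⟩ hq
  rw [mem_runStates] at hq
  rw [Finset.sum_apply]
  simp [hq.1]

end IsStationaryMean

/-! ### The minimax risk -/

/-- A machine on any finite set `V` of at most `S` states can be run as an `S`-state procedure,
and its asymptotic risk is the mean square error under a stationary distribution. -/
lemma exists_procedure_of_machine {Q : Type*} {V : Finset Q} {step : Q → Bool → Q}
    (hstep : ∀ q ∈ V, ∀ b, step q b ∈ V) (hV : V.Nonempty) (est : Q → I) {S : ℕ}
    (hS : V.card ≤ S) :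
    ∃ P : EstimationProcedure S, ∀ θ : I, ∃ E : (Q → ℝ) →ₗ[ℝ] ℝ,
      IsStationaryMean V step θ E ∧ P.risk θ = E (fun q => ((est q : ℝ) - θ) ^ 2) := by
  have : Nonempty V := hV.to_subtype
  obtain ⟨f⟩ : Nonempty (V ↪ Fin S) := Function.Embedding.nonempty_of_card_le (by simpa using hS)
  set r : Fin S → V := Function.invFun f with hr
  have hrf : ∀ v, r (f v) = v := Function.leftInverse_invFun f.injective
  let P : EstimationProcedure S :=
    { step := fun s b => f ⟨step (r s) b, hstep _ (r s).2 b⟩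
      estimate := fun s => est (r s)
      init := f (Classical.arbitrary V) }
  have hP : ∀ s b, ((r (P.step s b) : V) : Q) = step (r s) b := fun s b => by
    simp only [P, hrf]
  refine ⟨P, fun θ => ?_⟩
  obtain ⟨L, hL, hpos, hone, hinv⟩ := P.exists_stationary θ
  refine ⟨L.comp (LinearMap.funLeft ℝ ℝ fun s => (r s : Q)), ⟨?_, hone, ?_⟩, ?_⟩
  · exact fun h hh => hpos _ fun s => hh _ (r s).2
  · intro h
    refine Eq.trans (congrArg L ?_) (hinv fun s => h (r s))
    funext s
    simp only [EstimationProcedure.transition_apply, LinearMap.funLeft_apply, hP]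
  · exact tendsto_nhds_unique (P.tendsto_averageRisk θ)
      (hL fun s => ((P.estimate s : ℝ) - θ) ^ 2)

/-- Run lengths for a chain of `N + 1` cells: the run lengths at the boundary of the cells `i` and
`i + 1` separate parameters around `(i + 1) / (N + 1)`, and their total is quadratic in `N`. -/
lemma exists_cells (N : ℕ) : ∃ ℓ : Bool → ℕ → ℕ, (∀ b i, 1 ≤ ℓ b i) ∧
    ∑ i ∈ Finset.range (N + 1), (ℓ true i + ℓ false i) ≤ 4 * (N + 1) ^ 2 ∧
    ∀ i < N, ∀ θ : ℝ, 0 ≤ θ → θ ≤ 1 →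
      ((N + 1 : ℕ) * θ ≤ (i + 1 : ℕ) - 16 → FavoursOnes (ℓ false (i + 1)) (ℓ true i) (1 - θ)) ∧
      ((i + 1 : ℕ) + 16 ≤ (N + 1 : ℕ) * θ → FavoursOnes (ℓ true i) (ℓ false (i + 1)) θ) := by
  have h : ∀ i, ∃ k m : ℕ, 1 ≤ k ∧ 1 ≤ m ∧ (i < N →
      (k + m : ℝ) ≤ (N + 1 : ℕ) + 1 + (N + 1 : ℕ) * Real.log ((N + 1 : ℕ) / (i + 1 : ℕ))
        + (N + 1 : ℕ) * Real.log ((N + 1 : ℕ) / (N + 1 - (i + 1) : ℕ)) ∧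
      ∀ θ : ℝ, 0 ≤ θ → θ ≤ 1 →
        ((N + 1 : ℕ) * θ ≤ (i + 1 : ℕ) - 16 → FavoursOnes m k (1 - θ)) ∧
        ((i + 1 : ℕ) + 16 ≤ (N + 1 : ℕ) * θ → FavoursOnes k m θ)) := by
    intro i
    by_cases hi : i < N
    · obtain ⟨k, m, hk, hm, h1, h2⟩ :=
        exists_run_lengths (K := N + 1) (i := i + 1) (by omega) (by omega)
      exact ⟨k, m, hk, hm, fun _ => ⟨h1, h2⟩⟩
    · exact ⟨1, 1, le_rfl, le_rfl, fun h => absurd h hi⟩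
  choose k m hk hm hkm using h
  refine ⟨fun b i => if b then (if i < N then k i else 1) else (if i = 0 then 1 else m (i - 1)),
    ?_, ?_, ?_⟩
  · intro b i
    simp only
    split_ifs
    exacts [hk i, le_rfl, le_rfl, hm _]
  · have h1 : ∑ i ∈ Finset.range N, (k i + m i : ℝ) ≤
        N * (N + 2) + (N + 1) * (N + 1) + (N + 1) * (N + 1) := by
      refine (Finset.sum_le_sum fun i hi => (hkm i (Finset.mem_range.1 hi)).1).trans ?_
      have hl := sum_log_div_le (N + 1)
      rw [Nat.add_sub_cancel] at hl
      have hr : ∑ i ∈ Finset.range N, Real.log ((N + 1 : ℕ) / (N + 1 - (i + 1) : ℕ))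
          = ∑ i ∈ Finset.range N, Real.log ((N + 1 : ℕ) / (i + 1 : ℕ)) := by
        rw [← Finset.sum_range_reflect]
        refine Finset.sum_congr rfl fun i hi => ?_
        have := Finset.mem_range.1 hi
        rw [show N + 1 - (N - 1 - i + 1) = i + 1 by omega]
      rw [Finset.sum_add_distrib, Finset.sum_add_distrib, ← Finset.mul_sum, ← Finset.mul_sum, hr]
      rw [Finset.sum_const, Finset.card_range, nsmul_eq_mul]
      have := mul_le_mul_of_nonneg_left hl (Nat.cast_nonneg (α := ℝ) (N + 1))
      push_cast at this ⊢
      linarith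
    have h2 : ∑ i ∈ Finset.range N, (k i + m i) ≤
        N * (N + 2) + (N + 1) * (N + 1) + (N + 1) * (N + 1) := by exact_mod_cast h1
    rw [Finset.sum_add_distrib] at h2 ⊢
    have e1 : ∑ i ∈ Finset.range (N + 1), (if i < N then k i else 1)
        = ∑ i ∈ Finset.range N, k i + 1 := by
      rw [Finset.sum_range_succ, if_neg (lt_irrefl N),
        Finset.sum_congr rfl fun i hi => if_pos (Finset.mem_range.1 hi)]
    have e2 : ∑ i ∈ Finset.range (N + 1), (if i = 0 then 1 else m (i - 1))
        = ∑ i ∈ Finset.range N, m i + 1 := by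
      simp [Finset.sum_range_succ']
    simp only [if_true, Bool.false_eq_true, if_false, e1, e2]
    nlinarith
  · intro i hi
    simpa [hi] using (hkm i hi).2

/-- With `4 K ^ 2` states the risk is at most a constant over `K ^ 2`. -/
lemma minimaxRisk_le_of_sq_le {S N : ℕ} (hS : 4 * (N + 1) ^ 2 ≤ S) :
    minimaxRisk S ≤ 2035 / ((N + 1 : ℕ) : ℝ) ^ 2 := by
  obtain ⟨ℓ, hℓ, hcard, hsep⟩ := exists_cells N
  have hK : (0 : ℝ) < (N + 1 : ℕ) := by positivity
  let est : RunState → I := fun q => Set.projIcc 0 1 zero_le_one ((q.1 : ℝ) / (N + 1 : ℕ))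
  obtain ⟨P, hP⟩ := exists_procedure_of_machine (V := runStates N ℓ) (step := runStep N ℓ)
    (fun q hq b => runStep_mem hℓ hq b)
    ⟨(0, true, 0), mem_runStates.2 ⟨Nat.zero_le _, hℓ _ _⟩⟩ est
    (((card_runStates_le N ℓ).trans hcard).trans hS)
  refine minimaxRisk_le P fun θ => ?_
  obtain ⟨E, hE, hrisk⟩ := hP θ
  obtain ⟨h0, h1⟩ := θ.2
  set W : ℕ → ℝ := fun i => E (fun q => if q.1 = i then 1 else 0) with hWdef
  have hW : ∀ i, 0 ≤ W i := fun i => hE.nonneg _ fun q _ => by split_ifs <;> norm_num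
  have hsum : ∑ i ∈ Finset.range (N + 1), W i = 1 := by
    have := hE.apply_comp_fst fun _ => 1
    rw [hE.one] at this
    simpa using this.symm
  have hright : ∀ i < N, (N + 1 : ℕ) * (θ : ℝ) ≤ (i + 1 : ℕ) - 16 → 2 * W (i + 1) ≤ W i := by
    intro i hi ht
    have hf := (hsep i hi θ h0 h1).1 ht
    have hb := hE.cell_balance hℓ hi
    have hθ1 : (θ : ℝ) < 1 := by
      have : ((i + 1 : ℕ) : ℝ) ≤ (N + 1 : ℕ) := by exact_mod_cast (by omega : i + 1 ≤ N + 1)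
      by_contra hcon
      have h3 : (θ : ℝ) = 1 := le_antisymm h1 (not_lt.1 hcon)
      rw [h3] at ht
      linarith
    have hpow : (θ : ℝ) ^ ℓ true i < 1 :=
      pow_lt_one₀ h0 hθ1 (Nat.one_le_iff_ne_zero.1 (hℓ true i))
    have hpos : 0 < (1 - (θ : ℝ)) ^ ℓ false (i + 1) * (1 - (θ : ℝ) ^ ℓ true i) :=
      mul_pos (pow_pos (by linarith) _) (sub_pos.2 hpow)
    unfold FavoursOnes at hf
    rw [sub_sub_cancel] at hf
    refine le_of_mul_le_mul_left ?_ hpos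
    nlinarith [mul_le_mul_of_nonneg_right hf (hW i)]
  have hleft : ∀ i < N, (i + 1 : ℕ) + 16 ≤ (N + 1 : ℕ) * (θ : ℝ) → 2 * W i ≤ W (i + 1) := by
    intro i hi ht
    have hf := (hsep i hi θ h0 h1).2 ht
    have hb := hE.cell_balance hℓ hi
    have hθ0 : 0 < (θ : ℝ) := by
      by_contra hcon
      have h3 : (θ : ℝ) = 0 := le_antisymm (not_lt.1 hcon) h0
      rw [h3] at ht
      have : (0 : ℝ) ≤ (i + 1 : ℕ) := Nat.cast_nonneg _
      linarith
    have hpow : (1 - (θ : ℝ)) ^ ℓ false (i + 1) < 1 :=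
      pow_lt_one₀ (by linarith) (by linarith) (Nat.one_le_iff_ne_zero.1 (hℓ false (i + 1)))
    have hpos : 0 < (θ : ℝ) ^ ℓ true i * (1 - (1 - (θ : ℝ)) ^ ℓ false (i + 1)) :=
      mul_pos (pow_pos hθ0 _) (sub_pos.2 hpow)
    unfold FavoursOnes at hf
    refine le_of_mul_le_mul_left ?_ hpos
    nlinarith [mul_le_mul_of_nonneg_right hf (hW (i + 1))]
  have hmom := sum_mul_sq_le_of_decay (t := (N + 1 : ℕ) * (θ : ℝ)) (by positivity)
    (by push_cast; nlinarith [Nat.cast_nonneg (α := ℝ) N]) hW hsum hright hleft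
  have hest : ∀ q ∈ runStates N ℓ, ((est q : ℝ) - θ) ^ 2 = ((q.1 : ℝ) / (N + 1 : ℕ) - θ) ^ 2 := by
    rintro ⟨i, b, j⟩ hq
    have hi := (mem_runStates.1 hq).1
    have : ((i : ℝ) / (N + 1 : ℕ)) ∈ Set.Icc (0 : ℝ) 1 := by
      refine ⟨by positivity, ?_⟩
      rw [div_le_one hK]
      exact_mod_cast hi.trans (Nat.le_succ N)
    simp only [est]
    rw [Set.projIcc_of_mem zero_le_one this]
  rw [hrisk, hE.congr hest, hE.apply_comp_fst fun i => ((i : ℝ) / (N + 1 : ℕ) - θ) ^ 2,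
    le_div_iff₀ (by positivity), Finset.sum_mul]
  refine le_of_eq_of_le (Finset.sum_congr rfl fun i _ => ?_) hmom
  rw [mul_assoc, ← mul_pow, sub_mul, div_mul_cancel₀ _ hK.ne', mul_comm (θ : ℝ)]

theorem theorem1 :
    (∀ (S : ℕ) (P : EstimationProcedure S) (θ : I),
      Tendsto (P.averageRisk θ) atTop (𝓝 (P.risk θ))) ∧
    (fun S : ℕ => minimaxRisk S) =O[atTop] (fun S : ℕ => 1 / (S : ℝ)) := by
  refine ⟨fun S P θ => P.tendsto_averageRisk θ, ?_⟩
  refine Asymptotics.IsBigO.of_bound (16 * 2035) ?_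
  filter_upwards [eventually_ge_atTop 4] with S hS
  rw [Real.norm_of_nonneg (minimaxRisk_nonneg S), Real.norm_of_nonneg (by positivity)]
  have hpos : 1 ≤ Nat.sqrt (S / 4) := Nat.le_sqrt.2 (by omega)
  obtain ⟨N, hN⟩ : ∃ N, Nat.sqrt (S / 4) = N + 1 := ⟨Nat.sqrt (S / 4) - 1, by omega⟩
  have h1 := Nat.sqrt_le' (S / 4)
  have h2 := Nat.lt_succ_sqrt' (S / 4)
  rw [hN] at h1 h2
  have h3 : S ≤ 16 * (N + 1) ^ 2 := by
    have : S < 4 * (N + 1 + 1) ^ 2 := by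
      simp only [Nat.succ_eq_add_one] at h2; omega
    nlinarith
  refine (minimaxRisk_le_of_sq_le (N := N) (by omega)).trans ?_
  have h4 : (S : ℝ) ≤ 16 * ((N + 1 : ℕ) : ℝ) ^ 2 := by exact_mod_cast h3
  have hS0 : (0 : ℝ) < S := by exact_mod_cast (by omega : 0 < S)
  rw [mul_one_div, div_le_div_iff₀ (by positivity) hS0]
  nlinarith
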